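/- Let $\mathbf{CGp}$ be the category of compact Hausdorff topological groups and continuous group homomorphisms; this category has all coproducts, denoted $\coprod$. An embedding in $\mathbf{CGp}$ is a continuous homomorphism that is a homeomorphism onto its image (equivalently, since the groups are compact Hausdorff, an injective continuous homomorphism). Let $I$ be a finite set, let $H_i$, $G_i$ ($i\in I$) be compact groups, and let $\iota_i\colon H_i\to G_i$ be an embedding for every $i\in I$. Then the induced morphism of coproducts in $\mathbf{CGp}$, $$\coprod_{i\in I}\iota_i\colon\ \coprod_{i\in I}H_i\longrightarrow\coprod_{i\in I}G_i,$$ is again an embedding. -/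

import Mathlib

open CategoryTheory CategoryTheory.Limits

universe w u

/-- A compact group: a topological group whose underlying space is compact and Hausdorff. -/
structure CGp : Type (u + 1) where
  carrier : Type u
  [group : Group carrier]
  [topologicalSpace : TopologicalSpace carrier]
  [isTopologicalGroup : IsTopologicalGroup carrier]
  [compactSpace : CompactSpace carrier]
  [t2Space : T2Space carrier]

namespace CGp

instance : CoeSort CGp.{u} (Type u) := ⟨CGp.carrier⟩

attribute [instance] CGp.group CGp.topologicalSpace CGp.isTopologicalGroup
  CGp.compactSpace CGp.t2Space

/-- Morphisms of compact groups: continuous group homomorphisms. -/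
@[ext]
structure Hom (A B : CGp.{u}) where
  hom' : A →ₜ* B

instance : Category CGp.{u} where
  Hom A B := CGp.Hom A B
  id A := ⟨ContinuousMonoidHom.id A⟩
  comp f g := ⟨g.hom'.comp f.hom'⟩

instance : ConcreteCategory CGp.{u} (fun X Y => X →ₜ* Y) where
  hom f := f.hom'
  ofHom f := ⟨f⟩

/-- An embedding of compact groups: a continuous homomorphism that is a homeomorphism onto its
image. -/
def IsEmbedding {A B : CGp.{u}} (f : A ⟶ B) : Prop :=
  Topology.IsEmbedding (fun x : A => ConcreteCategory.hom f x)

/-! ### Existence of coproducts in `CGp`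

The coproduct of `G i` is the closure of the image of the free product of the `G i` in the
product of all compact groups that receive a homomorphism from the free product whose restriction
to every `G i` is continuous. Such groups with dense image are, up to isomorphism, carried by sets
of filters on the free product, which makes the product small. -/

section Coproduct

variable {I : Type u} (G : I → CGp.{u})

/-- The group-theoretic free product. -/
abbrev FreeProd : Type u := Monoid.CoprodI (fun i => (G i : Type u))

/-- Compact groups on a set of filters on the free product, with a homomorphism from the free
product that is continuous on all factors. -/
structure Compactification : Type u where
  carrier : Set (Filter (FreeProd G))
  [group : Group carrier]
  [topologicalSpace : TopologicalSpace carrier]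
  [isTopologicalGroup : IsTopologicalGroup carrier]
  [compactSpace : CompactSpace carrier]
  [t2Space : T2Space carrier]
  hom : FreeProd G →* carrier
  continuous_hom : ∀ i, Continuous fun x : G i => hom (Monoid.CoprodI.of x)

attribute [instance] Compactification.group Compactification.topologicalSpace
  Compactification.isTopologicalGroup Compactification.compactSpace Compactification.t2Space

/-- The diagonal homomorphism to the product of all compactifications. -/
def diag : FreeProd G →* ((j : Compactification G) → j.carrier) :=
  MonoidHom.pi fun j => j.hom

/-- The closure of the image of the free product. -/
def coprodSubgroup : Subgroup ((j : Compactification G) → j.carrier) :=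
  (diag G).range.topologicalClosure

instance : CompactSpace (coprodSubgroup G) :=
  isCompact_iff_compactSpace.mp
    (Subgroup.isClosed_topologicalClosure (diag G).range).isCompact

/-- The coproduct of compact groups. -/
def coprod : CGp.{u} where
  carrier := coprodSubgroup G

/-- The homomorphism from the free product to the coproduct. -/
def toCoprod : FreeProd G →* coprodSubgroup G :=
  (diag G).codRestrict _ fun x => Subgroup.le_topologicalClosure _ ⟨x, rfl⟩

theorem continuous_toCoprod_of (i : I) :
    Continuous fun x : G i => toCoprod G (Monoid.CoprodI.of x) :=
  Continuous.subtype_mk (continuous_pi (f := fun (x : G i) => diag G (Monoid.CoprodI.of x))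
    fun j => j.continuous_hom i) _

/-- The structure maps of the coproduct, as group homomorphisms. -/
def coprodInjHom (i : I) : G i →* coprodSubgroup G :=
  (toCoprod G).comp (Monoid.CoprodI.of (M := fun i => (G i : Type u)) (i := i))

/-- The structure maps of the coproduct. -/
def coprodInj (i : I) : G i ⟶ coprod G where
  hom' :=
    { toMonoidHom := coprodInjHom G i
      continuous_toFun := continuous_toCoprod_of G i }

theorem denseRange_toCoprod : DenseRange (toCoprod G) := by
  intro x
  rw [closure_subtype]
  have h : (Subtype.val '' Set.range (toCoprod G)) = ((diag G).range : Set _) := by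
    ext y
    constructor
    · rintro ⟨_, ⟨z, rfl⟩, rfl⟩
      exact ⟨z, rfl⟩
    · rintro ⟨z, rfl⟩
      exact ⟨_, ⟨z, rfl⟩, rfl⟩
  rw [h]
  exact x.2

variable {G}

theorem coprod_hom_ext {K : CGp.{u}} {f g : coprod G ⟶ K}
    (h : ∀ i, coprodInj G i ≫ f = coprodInj G i ≫ g) : f = g := by
  have hfg : f.hom'.toMonoidHom.comp (toCoprod G) =
      g.hom'.toMonoidHom.comp (toCoprod G) := by
    refine Monoid.CoprodI.ext_hom _ _ fun i => ?_
    ext x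
    exact congrArg (fun k : G i ⟶ K => k.hom' x) (h i)
  have key : (f.hom' : coprodSubgroup G → K) = g.hom' :=
    (denseRange_toCoprod G).equalizer f.hom'.continuous_toFun g.hom'.continuous_toFun
      (funext fun x => DFunLike.congr_fun hfg x)
  apply Hom.ext
  ext x
  exact congrFun key x

theorem exists_coprod_desc {K : CGp.{u}} (k : ∀ i, G i ⟶ K) :
    ∃ f : coprod G ⟶ K, ∀ i, coprodInj G i ≫ f = k i := by
  classical
  let φ : FreeProd G →* K := Monoid.CoprodI.lift fun i => ((k i).hom' : G i →* K)
  have hφ : ∀ i (x : G i), φ (Monoid.CoprodI.of x) = (k i).hom' x := fun i x => by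
    simp [φ]
  let L : Subgroup K := φ.range.topologicalClosure
  have hLc : CompactSpace L := isCompact_iff_compactSpace.mp
    (Subgroup.isClosed_topologicalClosure φ.range).isCompact
  let c : L → Filter (FreeProd G) := fun x => Filter.comap φ (nhds (x : K))
  have hc : Function.Injective c := by
    intro x y hxy
    have hx : (Filter.comap φ (nhds (x : K))).NeBot := by
      refine Filter.comap_neBot fun t ht => ?_
      obtain ⟨_, hy, z, rfl⟩ := mem_closure_iff_nhds.mp x.2 t ht
      exact ⟨z, hy⟩
    have h1 : Filter.Tendsto φ (Filter.comap φ (nhds (x : K))) (nhds (x : K)) :=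
      Filter.tendsto_comap
    have h2 : Filter.Tendsto φ (Filter.comap φ (nhds (x : K))) (nhds (y : K)) := by
      have : Filter.comap φ (nhds (x : K)) = Filter.comap φ (nhds (y : K)) := hxy
      rw [this]
      exact Filter.tendsto_comap
    exact Subtype.ext (tendsto_nhds_unique h1 h2)
  let e : Set.range c ≃ L := (Equiv.ofInjective c hc).symm
  let _ : Group (Set.range c) := e.group
  let _ : TopologicalSpace (Set.range c) := TopologicalSpace.induced e inferInstance
  let m : Set.range c ≃* L := e.mulEquiv
  let hm : Set.range c ≃ₜ L := e.toHomeomorphOfIsInducing ⟨rfl⟩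
  have : IsTopologicalGroup (Set.range c) := topologicalGroup_induced m
  have : CompactSpace (Set.range c) := hm.symm.compactSpace
  have : T2Space (Set.range c) := hm.symm.t2Space
  let ψ : FreeProd G →* L :=
    φ.codRestrict _ fun x => Subgroup.le_topologicalClosure _ ⟨x, rfl⟩
  let j : Compactification G :=
    { carrier := Set.range c
      hom := (m.symm : L →* Set.range c).comp ψ
      continuous_hom := fun i => by
        refine hm.symm.continuous.comp (Continuous.subtype_mk ?_ _)
        simp only [hφ]
        exact (k i).hom'.continuous_toFun }
  let p : coprodSubgroup G →* Set.range c :=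
    (Pi.evalMonoidHom (fun j : Compactification G => j.carrier) j).comp
      (coprodSubgroup G).subtype
  have hp : Continuous p := (continuous_apply j).comp continuous_subtype_val
  refine ⟨⟨{ toMonoidHom := (L.subtype.comp (m : Set.range c →* L)).comp p
             continuous_toFun := continuous_subtype_val.comp (hm.continuous.comp hp) }⟩,
    fun i => ?_⟩
  apply Hom.ext
  ext x
  change ((m (m.symm (ψ (Monoid.CoprodI.of x))) : L) : K) = (k i).hom' x
  rw [MulEquiv.apply_symm_apply]
  exact hφ i x

variable (G)

/-- `coprod G` is a coproduct of the compact groups `G i`. -/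
noncomputable def coprodIsColimit : IsColimit (Cofan.mk (coprod G) (coprodInj G)) :=
  Cofan.IsColimit.mk _ (fun s => (exists_coprod_desc fun i => s.inj i).choose)
    (fun s i => (exists_coprod_desc fun i => s.inj i).choose_spec i)
    (fun s _ hm => coprod_hom_ext fun i =>
      (hm i).trans ((exists_coprod_desc fun i => s.inj i).choose_spec i).symm)

instance : HasCoproduct G := ⟨⟨⟨_, coprodIsColimit G⟩⟩⟩

end Coproduct

instance : HasCoproducts.{u} CGp.{u} :=
  hasCoproducts_of_colimit_cofans (fun G => Cofan.mk (coprod G) (coprodInj G))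
    coprodIsColimit

instance : HasFiniteCoproducts CGp.{u} :=
  hasFiniteCoproducts_of_hasCoproducts CGp.{u}

end CGp

/-! A continuous injection from a compact space to a Hausdorff space is an embedding, so only the
kernel matters. Unitary representations separate the points of a compact group
(`exists_unitaryOp_ne_one`), so it suffices that every unitary representation `ρ` of `∐ H` on `ℂⁿ`
sits inside the pullback of one of `∐ G`: an element of the kernel then acts trivially in every `ρ`.

On each factor, the restriction of `ρ` to `H i` is contained in the restriction of a representation
of `G i` (`exists_extension_unitaryOp`). Trivial summands bring these to one `ℂᴺ`, in which all
copies of `ℂⁿ` are moved to the same position. The universal property glues them to a representation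
of `∐ G`. The common inclusion intertwines on a closed subgroup of `∐ H` containing every factor,
hence everywhere. No explicit description of the coproduct is needed.

The extension lemma averages over `H` to get an equivariant map `C(G, V) → V`, onto by Tietze.
Finite vectors are dense (Peter–Weyl) and `V` is finite-dimensional, so a finite-dimensional
invariant subspace already maps onto `V`; the adjoint, made isometric, embeds `V` in it. Density
comes from the spectral theorem for convolution operators, which are compact and commute with left
translation. -/

/-! ### Finite vectors of the left regular representation -/

section PeterWeyl

open MeasureTheory

variable {G : Type*} [Group G] [TopologicalSpace G] [IsTopologicalGroup G]

section FiniteVectors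

variable {V : Type*} [NormedAddCommGroup V] [NormedSpace ℂ V]

/-- Left translation on continuous functions. -/
def leftTranslate (a : G) : C(G, V) →ₗ[ℂ] C(G, V) where
  toFun f := f.comp ⟨fun x => a⁻¹ * x, by fun_prop⟩
  map_add' _ _ := rfl
  map_smul' _ _ := rfl

@[simp]
theorem leftTranslate_apply (a : G) (f : C(G, V)) (x : G) :
    leftTranslate a f x = f (a⁻¹ * x) := rfl

theorem leftTranslate_one (f : C(G, V)) : leftTranslate 1 f = f := by
  ext x; simp

theorem leftTranslate_mul (a b : G) (f : C(G, V)) :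
    leftTranslate (a * b) f = leftTranslate a (leftTranslate b f) := by
  ext x; simp [mul_assoc]

theorem continuous_leftTranslate (f : C(G, V)) : Continuous fun a : G => leftTranslate a f :=
  ContinuousMap.continuous_of_continuous_uncurry _
    (by change Continuous fun p : G × G => f (p.1⁻¹ * p.2); fun_prop)

/-- A subspace of continuous functions is left invariant if it is stable under left translation. -/
def LeftInvariant (S : Submodule ℂ C(G, V)) : Prop :=
  ∀ a : G, ∀ s ∈ S, leftTranslate a s ∈ S

theorem LeftInvariant.sup {S T : Submodule ℂ C(G, V)} (hS : LeftInvariant S)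
    (hT : LeftInvariant T) : LeftInvariant (S ⊔ T) := fun a =>
  (sup_le ((show S ≤ S.comap (leftTranslate a) from hS a).trans (Submodule.comap_mono le_sup_left))
    ((show T ≤ T.comap (leftTranslate a) from hT a).trans (Submodule.comap_mono le_sup_right)) :
    S ⊔ T ≤ (S ⊔ T).comap (leftTranslate a))

theorem LeftInvariant.iSup {ι : Sort*} {S : ι → Submodule ℂ C(G, V)}
    (hS : ∀ i, LeftInvariant (S i)) : LeftInvariant (⨆ i, S i) := fun a =>
  (iSup_le fun i => (show S i ≤ (S i).comap (leftTranslate a) from hS i a).trans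
    (Submodule.comap_mono (le_iSup S i)) : ⨆ i, S i ≤ (⨆ i, S i).comap (leftTranslate a))

variable (G V) in
/-- The continuous functions that lie in a finite-dimensional left invariant subspace. -/
def finiteVectors : Submodule ℂ C(G, V) where
  carrier := {f | ∃ S : Submodule ℂ C(G, V), FiniteDimensional ℂ S ∧ LeftInvariant S ∧ f ∈ S}
  zero_mem' := ⟨⊥, inferInstance, fun a s hs => by simp_all, by simp⟩
  add_mem' := by
    rintro f g ⟨S, hS, hS', hf⟩ ⟨T, hT, hT', hg⟩
    exact ⟨S ⊔ T, inferInstance, hS'.sup hT', Submodule.add_mem_sup hf hg⟩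
  smul_mem' := by
    rintro c f ⟨S, hS, hS', hf⟩
    exact ⟨S, hS, hS', S.smul_mem c hf⟩

theorem mem_finiteVectors {f : C(G, V)} : f ∈ finiteVectors G V ↔
    ∃ S : Submodule ℂ C(G, V), FiniteDimensional ℂ S ∧ LeftInvariant S ∧ f ∈ S := Iff.rfl

end FiniteVectors

/-! ### Convolution operators -/

/-- The kernel functions `y ↦ φ (x⁻¹ * y)` of the convolution operator. -/
noncomputable def convKernel (φ : C(G, ℝ)) : C(G, C(G, ℂ)) :=
  ContinuousMap.curry ⟨fun p : G × G => (φ (p.1⁻¹ * p.2) : ℂ), by fun_prop⟩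

@[simp]
theorem convKernel_apply (φ : C(G, ℝ)) (x y : G) : convKernel φ x y = (φ (x⁻¹ * y) : ℂ) := rfl

variable [CompactSpace G]

section Convolution

variable [MeasurableSpace G] [BorelSpace G] (μ : Measure G) [IsFiniteMeasure μ]

/-- The kernel functions of the convolution operator in `L²`. -/
noncomputable def convKernelLp (φ : C(G, ℝ)) : C(G, Lp ℂ 2 μ) :=
  ⟨fun x => ContinuousMap.toLp 2 μ ℂ (convKernel φ x), by fun_prop⟩

/-- The convolution operator `f ↦ (x ↦ ∫ φ (x⁻¹ * y) * f y)` from `L²` to continuous functions. -/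
noncomputable def convOp (φ : C(G, ℝ)) : Lp ℂ 2 μ →L[ℂ] C(G, ℂ) :=
  LinearMap.mkContinuous
    { toFun := fun f => ⟨fun x => inner ℂ (convKernelLp μ φ x) f, by fun_prop⟩
      map_add' := fun f g => by ext x; simp [inner_add_right]
      map_smul' := fun c f => by ext x; simp [inner_smul_right] }
    ‖convKernelLp μ φ‖ (fun f => by
      rw [ContinuousMap.norm_le _ (by positivity)]
      intro x
      exact (norm_inner_le_norm (𝕜 := ℂ) _ f).trans
        (mul_le_mul_of_nonneg_right (ContinuousMap.norm_coe_le_norm _ x) (norm_nonneg _)))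

theorem convOp_apply (φ : C(G, ℝ)) (f : Lp ℂ 2 μ) (x : G) :
    convOp μ φ f x = inner ℂ (convKernelLp μ φ x) f := rfl

theorem convOp_toLp (φ : C(G, ℝ)) (f : C(G, ℂ)) (x : G) :
    convOp μ φ (ContinuousMap.toLp 2 μ ℂ f) x = ∫ y, f y * (φ (x⁻¹ * y) : ℂ) ∂μ := by
  rw [convOp_apply]
  change inner ℂ (ContinuousMap.toLp 2 μ ℂ (convKernel φ x)) _ = _
  rw [ContinuousMap.inner_toLp]
  simp

/-- Substituting `a * y` for `y` leaves the measure unchanged. This equivariance is what makes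
eigenspaces left invariant. -/
theorem convOp_leftTranslate [μ.IsMulLeftInvariant] (φ : C(G, ℝ)) (a : G) (f : C(G, ℂ)) :
    convOp μ φ (ContinuousMap.toLp 2 μ ℂ (leftTranslate a f)) =
      leftTranslate a (convOp μ φ (ContinuousMap.toLp 2 μ ℂ f)) := by
  ext x
  rw [leftTranslate_apply, convOp_toLp, convOp_toLp, ← integral_mul_left_eq_self _ a]
  simp [mul_assoc]

/-- Arzelà–Ascoli: by Cauchy–Schwarz the images of the unit ball are uniformly bounded, and the `L²`
distance of the kernels at two points is a common modulus of continuity. -/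
theorem isCompact_closure_image_convOp (φ : C(G, ℝ)) :
    IsCompact (closure (convOp μ φ '' Metric.closedBall 0 1)) := by
  let e := ContinuousMap.isometryEquivBoundedOfCompact G ℂ
  let A : Set (BoundedContinuousFunction G ℂ) := e '' (convOp μ φ '' Metric.closedBall 0 1)
  have hA : IsCompact (closure A) := by
    refine BoundedContinuousFunction.arzela_ascoli
      (Metric.closedBall 0 ‖convOp μ φ‖) (isCompact_closedBall _ _) A ?_ ?_
    · rintro _ x ⟨_, ⟨f, hf, rfl⟩, rfl⟩
      rw [mem_closedBall_zero_iff] at hf ⊢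
      calc ‖convOp μ φ f x‖ ≤ ‖convOp μ φ f‖ := ContinuousMap.norm_coe_le_norm _ x
        _ ≤ ‖convOp μ φ‖ * ‖f‖ := ContinuousLinearMap.le_opNorm _ _
        _ ≤ ‖convOp μ φ‖ := mul_le_of_le_one_right (norm_nonneg _) hf
    · intro x₀
      refine Metric.equicontinuousAt_of_continuity_modulus
        (fun x => ‖convKernelLp μ φ x₀ - convKernelLp μ φ x‖) ?_ _ (.of_forall ?_)
      · have : Continuous fun x => ‖convKernelLp μ φ x₀ - convKernelLp μ φ x‖ := by fun_prop
        simpa using this.tendsto x₀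
      · rintro x ⟨_, _, ⟨f, hf, rfl⟩, rfl⟩
        rw [mem_closedBall_zero_iff] at hf
        change dist (convOp μ φ f x₀) (convOp μ φ f x) ≤ _
        rw [convOp_apply, convOp_apply, dist_eq_norm, ← inner_sub_left]
        exact (norm_inner_le_norm _ _).trans (mul_le_of_le_one_right (norm_nonneg _) hf)
  have h := hA.image e.symm.continuous
  refine h.of_isClosed_subset isClosed_closure (closure_minimal ?_ h.isClosed)
  rintro f hf
  exact ⟨e f, subset_closure ⟨f, hf, rfl⟩, e.symm_apply_apply f⟩

/-- The convolution operator on `L²`. -/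
noncomputable def convOpLp (φ : C(G, ℝ)) : Lp ℂ 2 μ →L[ℂ] Lp ℂ 2 μ :=
  (ContinuousMap.toLp 2 μ ℂ).comp (convOp μ φ)

theorem isCompactOperator_convOpLp (φ : C(G, ℝ)) : IsCompactOperator (convOpLp μ φ) := by
  have h : IsCompactOperator (convOp μ φ) :=
    (isCompactOperator_iff_isCompact_closure_image_closedBall
      (convOp μ φ : Lp ℂ 2 μ →ₗ[ℂ] C(G, ℂ)) one_pos).2 (isCompact_closure_image_convOp μ φ)
  exact h.clm_comp (ContinuousMap.toLp 2 μ ℂ)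

/-- The kernel `φ (x⁻¹ * y)` is real and symmetric in `x` and `y`, so Fubini gives symmetry on the
dense subspace of continuous functions. -/
theorem isSymmetric_convOpLp [T2Space G] [μ.WeaklyRegular] {φ : C(G, ℝ)} (hφ : ∀ x, φ x⁻¹ = φ x) :
    (convOpLp μ φ : Lp ℂ 2 μ →ₗ[ℂ] Lp ℂ 2 μ).IsSymmetric := by
  have hd := ContinuousMap.toLp_denseRange (α := G) ℂ μ (p := 2) ℂ (by simp)
  intro f g
  change inner ℂ (convOpLp μ φ f) g = inner ℂ f (convOpLp μ φ g)
  induction f using hd.induction_on with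
  | hp => exact isClosed_eq (by fun_prop) (by fun_prop)
  | ih f =>
  induction g using hd.induction_on with
  | hp => exact isClosed_eq (by fun_prop) (by fun_prop)
  | ih g =>
  change inner ℂ (ContinuousMap.toLp 2 μ ℂ (convOp μ φ (ContinuousMap.toLp 2 μ ℂ f))) _ =
    inner ℂ _ (ContinuousMap.toLp 2 μ ℂ (convOp μ φ (ContinuousMap.toLp 2 μ ℂ g)))
  rw [ContinuousMap.inner_toLp, ContinuousMap.inner_toLp]
  simp only [convOp_toLp, ← integral_conj, ← integral_const_mul, ← integral_mul_const]
  rw [integral_integral_swap_of_hasCompactSupport (by fun_prop) (.of_compactSpace _)]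
  refine integral_congr_ae (.of_forall fun x => integral_congr_ae (.of_forall fun y => ?_))
  have : φ (x⁻¹ * y) = φ (y⁻¹ * x) := by rw [← hφ (x⁻¹ * y)]; simp
  simp only [map_mul, Complex.conj_ofReal, this]
  ring

/-- For `c ≠ 0` the eigenspace is finite-dimensional by compactness, and its continuous members form
a left invariant space containing `convOp μ φ f`. For `c = 0` the image is zero, because a
continuous function vanishing in `L²` vanishes. -/
theorem convOp_mem_finiteVectors_of_mem_eigenspace [μ.IsMulLeftInvariant] [μ.IsOpenPosMeasure]
    (φ : C(G, ℝ)) (c : ℂ) {f : Lp ℂ 2 μ}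
    (hf : f ∈ Module.End.eigenspace (convOpLp μ φ : Module.End ℂ (Lp ℂ 2 μ)) c) :
    convOp μ φ f ∈ finiteVectors G ℂ := by
  have hf' : ContinuousMap.toLp 2 μ ℂ (convOp μ φ f) = c • f := Module.End.mem_eigenspace_iff.1 hf
  by_cases hc : c = 0
  · have : convOp μ φ f = 0 := ContinuousMap.toLp_injective μ (by rw [hf', hc]; simp)
    rw [this]
    exact zero_mem _
  let S : Submodule ℂ C(G, ℂ) :=
    LinearMap.eqLocus ((convOp μ φ).comp (ContinuousMap.toLp 2 μ ℂ)).toLinearMap (c • LinearMap.id)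
  have hS : ∀ s, s ∈ S ↔ convOp μ φ (ContinuousMap.toLp 2 μ ℂ s) = c • s := fun s => Iff.rfl
  refine ⟨S, ?_, fun a s hs => ?_, ?_⟩
  · have := ContinuousLinearMap.finite_dimensional_eigenspace (isCompactOperator_convOpLp μ φ) c hc
    let j : S →ₗ[ℂ] Module.End.eigenspace (convOpLp μ φ : Module.End ℂ (Lp ℂ 2 μ)) c :=
      ((ContinuousMap.toLp 2 μ ℂ).toLinearMap.comp S.subtype).codRestrict _ fun s => by
        rw [Module.End.mem_eigenspace_iff]
        change ContinuousMap.toLp 2 μ ℂ (convOp μ φ (ContinuousMap.toLp 2 μ ℂ (s : C(G, ℂ)))) = _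
        rw [(hS s).1 s.2, map_smul]
        rfl
    refine FiniteDimensional.of_injective j fun s t hst => ?_
    exact Subtype.ext (ContinuousMap.toLp_injective μ (congrArg Subtype.val hst))
  · rw [hS] at hs ⊢
    rw [convOp_leftTranslate, hs, map_smul]
  · rw [hS, hf', map_smul]

/-- By the spectral theorem the eigenvectors span a dense subspace of `L²`, and `convOp μ φ` is
continuous from `L²` to the uniform norm. -/
theorem convOp_mem_closure_finiteVectors [T2Space G] [μ.IsMulLeftInvariant]
    [μ.IsOpenPosMeasure] [μ.WeaklyRegular] {φ : C(G, ℝ)} (hφ : ∀ x, φ x⁻¹ = φ x) (f : Lp ℂ 2 μ) :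
    convOp μ φ f ∈ closure (finiteVectors G ℂ : Set C(G, ℂ)) := by
  have h := ContinuousLinearMap.orthogonalComplement_iSup_eigenspaces_eq_bot
    (isCompactOperator_convOpLp μ φ) (isSymmetric_convOpLp μ hφ)
  rw [← Submodule.topologicalClosure_eq_top_iff] at h
  have hf : f ∈ closure ((⨆ c, Module.End.eigenspace
      (convOpLp μ φ : Module.End ℂ (Lp ℂ 2 μ)) c : Submodule ℂ (Lp ℂ 2 μ)) : Set (Lp ℂ 2 μ)) := by
    rw [← Submodule.topologicalClosure_coe, h]
    trivial
  refine map_mem_closure (convOp μ φ).continuous hf fun g hg => ?_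
  have : (⨆ c, Module.End.eigenspace (convOpLp μ φ : Module.End ℂ (Lp ℂ 2 μ)) c) ≤
      (finiteVectors G ℂ).comap (convOp μ φ).toLinearMap :=
    iSup_le fun c _ hg => convOp_mem_finiteVectors_of_mem_eigenspace μ φ c hg
  exact this hg

/-- Approximate identities for convolution. -/
theorem exists_convOp_sub_le [T2Space G] [μ.IsMulLeftInvariant] [μ.IsOpenPosMeasure]
    (f : C(G, ℂ)) {ε : ℝ} (hε : 0 < ε) : ∃ φ : C(G, ℝ), (∀ x, φ x⁻¹ = φ x) ∧
      ‖convOp μ φ (ContinuousMap.toLp 2 μ ℂ f) - f‖ ≤ ε := by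
  let R : C(G, C(G, ℂ)) := ContinuousMap.curry ⟨fun p : G × G => f (p.2 * p.1), by fun_prop⟩
  have hR : ∀ u x, R u x = f (x * u) := fun _ _ => rfl
  -- On `U`, right translation moves `f` by less than `ε` uniformly in `x`.
  let U : Set G := {u | dist (R u) (R 1) < ε}
  have hU : IsOpen U := isOpen_lt (by fun_prop) continuous_const
  obtain ⟨ψ, hψ0, hψ1, hψ⟩ := exists_continuous_zero_one_of_isClosed (s := Uᶜ) (t := {(1 : G)})
    hU.isClosed_compl isClosed_singleton (by simp [U, hε])
  -- The product with the inverted bump is symmetric and still vanishes off `U`.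
  let φ₀ : C(G, ℝ) := ⟨fun x => ψ x * ψ x⁻¹, by fun_prop⟩
  have hφ₀ : ∀ x, φ₀ x = ψ x * ψ x⁻¹ := fun _ => rfl
  have hpos : 0 < ∫ x, φ₀ x ∂μ := by
    refine φ₀.continuous.integral_pos_of_hasCompactSupport_nonneg_nonzero (x := 1)
      (.of_compactSpace _) (fun x => mul_nonneg (hψ x).1 (hψ x⁻¹).1) ?_
    have : ψ 1 = 1 := hψ1 rfl
    simp [hφ₀, this]
  set I := ∫ x, φ₀ x ∂μ
  let φ : C(G, ℝ) := I⁻¹ • φ₀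
  have hφ : ∀ x, φ x = I⁻¹ * φ₀ x := fun _ => rfl
  have hφI : ∫ x, φ x ∂μ = 1 := by
    simp only [hφ, integral_const_mul]
    exact inv_mul_cancel₀ hpos.ne'
  have hφnn : ∀ x, 0 ≤ φ x := fun x =>
    mul_nonneg (by positivity) (mul_nonneg (hψ x).1 (hψ x⁻¹).1)
  have hint : ∀ {E : Type} [NormedAddCommGroup E] {g : G → E}, Continuous g → Integrable g μ :=
    fun hg => hg.integrable_of_hasCompactSupport (.of_compactSpace _)
  refine ⟨φ, fun x => by simp [hφ, hφ₀, mul_comm], ?_⟩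
  rw [ContinuousMap.norm_le _ hε.le]
  intro x
  -- With `y = x * u` the convolution becomes the average of `f (x * u)` with weight `φ u`.
  rw [ContinuousMap.sub_apply, convOp_toLp, ← integral_mul_left_eq_self _ x]
  have h1 : f x = ∫ u, f x * (φ u : ℂ) ∂μ := by
    rw [integral_const_mul, integral_complex_ofReal, hφI]
    simp
  simp only [inv_mul_cancel_left]
  conv_lhs => rw [h1]
  rw [← integral_sub (hint (by fun_prop)) (hint (by fun_prop))]
  calc ‖∫ u, f (x * u) * (φ u : ℂ) - f x * (φ u : ℂ) ∂μ‖
      ≤ ∫ u, ε * φ u ∂μ := by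
        refine norm_integral_le_of_norm_le (hint (by fun_prop)) (.of_forall fun u => ?_)
        rw [← sub_mul, norm_mul, Complex.norm_real, Real.norm_of_nonneg (hφnn u)]
        by_cases hu : u ∈ U
        · refine mul_le_mul_of_nonneg_right ?_ (hφnn u)
          have := (ContinuousMap.dist_apply_le_dist (f := R u) (g := R 1) x).trans hu.le
          simpa [hR, dist_eq_norm] using this
        · have : ψ u = 0 := hψ0 hu
          simp [hφ, hφ₀, this]
    _ = ε := by rw [integral_const_mul, hφI, mul_one]

end Convolution

/-- The **Peter–Weyl theorem**: the finite vectors are dense in the continuous functions. -/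
theorem dense_finiteVectors_complex [T2Space G] : Dense (finiteVectors G ℂ : Set C(G, ℂ)) := by
  let _ : MeasurableSpace G := borel G
  have : BorelSpace G := ⟨rfl⟩
  let μ : Measure G := Measure.haarMeasure ⊤
  intro f
  rw [← closure_closure, Metric.mem_closure_iff]
  intro ε hε
  obtain ⟨φ, hφ, h⟩ := exists_convOp_sub_le μ f (half_pos hε)
  refine ⟨_, convOp_mem_closure_finiteVectors μ hφ (ContinuousMap.toLp 2 μ ℂ f), ?_⟩
  rw [dist_comm, dist_eq_norm]
  linarith

end PeterWeyl

/-! ### Unitary representations from finite vectors -/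

section Representations

open MeasureTheory

/-- The group of unitary operators of `ℂⁿ`. -/
abbrev UnitaryOp (n : ℕ) : Type :=
  unitary (EuclideanSpace ℂ (Fin n) →L[ℂ] EuclideanSpace ℂ (Fin n))

instance (n : ℕ) : ContinuousStar (EuclideanSpace ℂ (Fin n) →L[ℂ] EuclideanSpace ℂ (Fin n)) :=
  ⟨(ContinuousLinearMap.adjoint (𝕜 := ℂ) (E := EuclideanSpace ℂ (Fin n))).continuous⟩

instance (n : ℕ) : CompactSpace (UnitaryOp n) := by
  let E := EuclideanSpace ℂ (Fin n)
  have : ProperSpace (E →L[ℂ] E) := FiniteDimensional.proper ℂ _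
  refine isCompact_iff_compactSpace.1 (Metric.isCompact_of_isClosed_isBounded ?_ ?_)
  · have : (unitary (E →L[ℂ] E) : Set (E →L[ℂ] E)) =
        {u | star u * u = 1} ∩ {u | u * star u = 1} := rfl
    rw [this]
    exact (isClosed_eq (continuous_star.mul continuous_id) continuous_const).inter
      (isClosed_eq (continuous_id.mul continuous_star) continuous_const)
  · refine (Metric.isBounded_closedBall (x := (0 : E →L[ℂ] E)) (r := 1)).subset fun u hu => ?_
    rw [mem_closedBall_zero_iff]
    refine ContinuousLinearMap.opNorm_le_bound _ zero_le_one fun v => ?_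
    rw [one_mul, ContinuousLinearMap.norm_map_of_mem_unitary hu]

variable {G : Type*} [Group G] [TopologicalSpace G]

/-- A strongly continuous isometric action on `ℂⁿ` is a continuous unitary representation. -/
theorem exists_unitaryOp_of_isometric {n : ℕ}
    (A : G → EuclideanSpace ℂ (Fin n) →ₗ[ℂ] EuclideanSpace ℂ (Fin n))
    (h1 : ∀ v, A 1 v = v) (hmul : ∀ a b v, A (a * b) v = A a (A b v))
    (hnorm : ∀ a v, ‖A a v‖ = ‖v‖) (hcont : ∀ v, Continuous fun a => A a v) :
    ∃ σ : G →ₜ* UnitaryOp n, ∀ a v, (σ a : EuclideanSpace ℂ (Fin n) →L[ℂ] _) v = A a v := by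
  let E := EuclideanSpace ℂ (Fin n)
  let e : G →* (E ≃ₗᵢ[ℂ] E) :=
    MonoidHom.mk' (fun a => ⟨LinearEquiv.ofLinearMap (A a) (A a⁻¹)
      (by ext1 v; simp [← hmul, h1]) (by ext1 v; simp [← hmul, h1]), hnorm a⟩)
      (fun a b => by ext1 v; exact hmul a b v)
  let σ : G →* UnitaryOp n := Unitary.linearIsometryEquiv.symm.toMonoidHom.comp e
  have hσ : ∀ a v, (σ a : E →L[ℂ] E) v = A a v := fun a v => rfl
  refine ⟨⟨σ, ?_⟩, hσ⟩
  refine Continuous.subtype_mk (f := fun a => (σ a : E →L[ℂ] E)) ?_ _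
  rw [continuous_clm_apply]
  exact hcont

variable [IsTopologicalGroup G] [CompactSpace G]

/-- A finite-dimensional left invariant space of continuous functions is unitarizable. -/
theorem LeftInvariant.exists_unitaryOp {V : Type*} [NormedAddCommGroup V] [InnerProductSpace ℂ V]
    [SecondCountableTopology V] {S : Submodule ℂ C(G, V)} [FiniteDimensional ℂ S]
    (hS : LeftInvariant S) :
    ∃ (n : ℕ) (e : S ≃ₗ[ℂ] EuclideanSpace ℂ (Fin n)) (σ : G →ₜ* UnitaryOp n),
      ∀ (a : G) (s : S),
        (σ a : EuclideanSpace ℂ (Fin n) →L[ℂ] _) (e s) = e ⟨leftTranslate a s, hS a s s.2⟩ := by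
  let _ : MeasurableSpace G := borel G
  have : BorelSpace G := ⟨rfl⟩
  let μ : Measure G := Measure.haarMeasure ⊤
  -- Haar measure makes the `L²` norm left invariant, so `S` with the `L²` inner product is a
  -- unitary representation.
  let j : C(G, V) →ₗ[ℂ] Lp V 2 μ := (ContinuousMap.toLp 2 μ ℂ).toLinearMap
  have hj : Function.Injective j := ContinuousMap.toLp_injective μ
  have hjn : ∀ (a : G) (f : C(G, V)), ‖j (leftTranslate a f)‖ = ‖j f‖ := by
    intro a f
    have h : ∀ g : C(G, V), ‖j g‖ = (eLpNorm g 2 μ).toReal := fun g => by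
      rw [Lp.norm_def]
      exact congrArg _ (eLpNorm_congr_ae (ContinuousMap.coeFn_toLp μ g))
    rw [h, h]
    congr 1
    have hf : AEStronglyMeasurable f μ :=
      (f.continuous.integrable_of_hasCompactSupport (.of_compactSpace _)).aestronglyMeasurable
    exact eLpNorm_comp_measurePreserving hf (measurePreserving_mul_left μ a⁻¹)
  let M : Submodule ℂ (Lp V 2 μ) := S.map j
  let eM : S ≃ₗ[ℂ] M := S.equivMapOfInjective j hj
  have : FiniteDimensional ℂ M := eM.finiteDimensional
  let b : M ≃ₗᵢ[ℂ] EuclideanSpace ℂ (Fin (Module.finrank ℂ M)) := (stdOrthonormalBasis ℂ M).repr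
  let e : S ≃ₗ[ℂ] EuclideanSpace ℂ (Fin (Module.finrank ℂ M)) := eM.trans b.toLinearEquiv
  have he : ∀ s : S, ‖e s‖ = ‖j s‖ := fun s => b.norm_map (eM s)
  let L : G → S →ₗ[ℂ] S := fun a => (leftTranslate a).restrict (hS a)
  have hL : ∀ a s, ((L a s : S) : C(G, V)) = leftTranslate a s := fun _ _ => rfl
  have hec : Continuous e := LinearMap.continuous_of_finiteDimensional e.toLinearMap
  obtain ⟨σ, hσ⟩ := exists_unitaryOp_of_isometric
    (fun a => e.toLinearMap ∘ₗ L a ∘ₗ e.symm.toLinearMap)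
    (fun v => by
      have : L 1 (e.symm v) = e.symm v := Subtype.ext (leftTranslate_one _)
      simp [this])
    (fun a b v => by
      have : L (a * b) (e.symm v) = L a (L b (e.symm v)) := Subtype.ext (leftTranslate_mul _ _ _)
      simp [this])
    (fun a v => by
      obtain ⟨s, rfl⟩ := e.surjective v
      simp [he, hL, hjn])
    (fun v => by
      refine hec.comp (Continuous.subtype_mk (continuous_leftTranslate _) _))
  refine ⟨_, e, σ, fun a s => ?_⟩
  rw [hσ]
  simp
  rfl

variable [T2Space G]

/-- Unitary representations separate the points of a compact group. -/
theorem exists_unitaryOp_ne_one {x : G} (hx : x ≠ 1) :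
    ∃ (n : ℕ) (σ : G →ₜ* UnitaryOp n), σ x ≠ 1 := by
  obtain ⟨ψ, hψ0, hψ1, -⟩ := exists_continuous_zero_one_of_isClosed (s := {x⁻¹}) (t := {(1 : G)})
    isClosed_singleton isClosed_singleton (by simpa using hx)
  -- The value of `leftTranslate x f` at `1` is `f x⁻¹`, so translation by `x` moves every `f` in
  -- `U`.
  let U : Set C(G, ℂ) := {f | f x⁻¹ ≠ f 1}
  have hU : IsOpen U := isOpen_ne_fun (by fun_prop) (by fun_prop)
  obtain ⟨f, hf, hfin⟩ := (dense_finiteVectors_complex (G := G)).inter_open_nonempty U hU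
    ⟨⟨fun y => (ψ y : ℂ), by fun_prop⟩, by
      have h0 : ψ x⁻¹ = 0 := hψ0 rfl
      have h1 : ψ 1 = 1 := hψ1 rfl
      simp [U, h0, h1]⟩
  obtain ⟨S, _, hS, hfS⟩ := mem_finiteVectors.1 hfin
  obtain ⟨n, e, σ, hσ⟩ := hS.exists_unitaryOp
  refine ⟨n, σ, fun h => hf ?_⟩
  have h2 := hσ x ⟨f, hfS⟩
  rw [h] at h2
  have h3 : (⟨f, hfS⟩ : S) = ⟨leftTranslate x f, _⟩ := e.injective h2
  have h4 := congrArg (fun g : S => (g : C(G, ℂ)) 1) h3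
  simpa using h4.symm

/-- The **Peter–Weyl theorem** for vector-valued functions. -/
theorem dense_finiteVectors {V : Type*} [NormedAddCommGroup V] [NormedSpace ℂ V]
    [FiniteDimensional ℂ V] : Dense (finiteVectors G V : Set C(G, V)) := by
  have hsmul : ∀ (v : V) (f : C(G, ℂ)),
      ContinuousMap.comp ⟨fun c : ℂ => c • v, by fun_prop⟩ f ∈
        closure (finiteVectors G V : Set C(G, V)) := by
    intro v f
    let m : C(G, ℂ) →ₗ[ℂ] C(G, V) :=
      { toFun := fun f => ContinuousMap.comp ⟨fun c : ℂ => c • v, by fun_prop⟩ f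
        map_add' := fun f g => by ext x; simp [add_smul]
        map_smul' := fun c f => by ext x; simp [mul_smul] }
    have hm : Continuous m := ContinuousMap.continuous_postcomp _
    refine map_mem_closure hm (dense_finiteVectors_complex f) ?_
    rintro g ⟨S, hfd, hS, hg⟩
    refine ⟨S.map m, inferInstance, ?_, Submodule.mem_map_of_mem hg⟩
    rintro a _ ⟨s, hs, rfl⟩
    exact ⟨_, hS a s hs, rfl⟩
  intro f
  let b := Module.finBasis ℂ V
  have hf : f = ∑ i, ContinuousMap.comp ⟨fun c : ℂ => c • b i, by fun_prop⟩
      (⟨fun x => b.equivFun (f x) i, by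
        have := LinearMap.continuous_of_finiteDimensional b.equivFun.toLinearMap
        have h2 : Continuous fun x => b.equivFun (f x) := this.comp f.continuous
        exact (continuous_apply i).comp h2⟩ : C(G, ℂ)) := by
    ext x
    simp only [ContinuousMap.sum_apply, ContinuousMap.comp_apply, ContinuousMap.coe_mk]
    exact (b.sum_equivFun (f x)).symm
  rw [hf, ← Submodule.topologicalClosure_coe]
  exact Submodule.sum_mem _ fun i _ => hsmul _ _

end Representations

/-! ### Restricting unitary representations to subgroups -/

section Restriction

open MeasureTheory

/-- Every injective operator `B` of finite-dimensional Hilbert spaces can be precomposed with an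
operator `A` to an isometry, where `A` commutes with everything that commutes with `B† B`. -/
theorem exists_comp_isometry {V E : Type*} [NormedAddCommGroup V] [InnerProductSpace ℂ V]
    [FiniteDimensional ℂ V] [CompleteSpace V] [NormedAddCommGroup E] [InnerProductSpace ℂ E]
    [CompleteSpace E] (B : V →L[ℂ] E) (hB : Function.Injective B) :
    ∃ A : V →L[ℂ] V, (∀ v, ‖B (A v)‖ = ‖v‖) ∧
      ∀ u : V →L[ℂ] V, Commute u (ContinuousLinearMap.adjoint B ∘L B) → Commute u A := by
  set Q : V →L[ℂ] V := ContinuousLinearMap.adjoint B ∘L B with hQ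
  have hQ0 : 0 ≤ Q := by
    rw [ContinuousLinearMap.nonneg_iff_isPositive]
    exact ContinuousLinearMap.isPositive_adjoint_comp_self B
  have hQi : Function.Injective Q := by
    rw [injective_iff_map_eq_zero]
    intro v hv
    have h : inner ℂ (B v) (B v) = 0 := by
      rw [← ContinuousLinearMap.adjoint_inner_right]
      change inner ℂ v (Q v) = 0
      rw [hv, inner_zero_right]
    exact hB (by rw [inner_self_eq_zero.1 h, map_zero])
  have hQu : IsUnit Q := by
    rw [ContinuousLinearMap.isUnit_iff_bijective]
    exact ⟨hQi, (LinearMap.injective_iff_surjective (f := Q.toLinearMap)).1 hQi⟩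
  have hQs : IsStrictlyPositive Q := IsStrictlyPositive.iff_of_unital.2 ⟨hQ0, hQu⟩
  -- Polar decomposition: `B Q^(-1/2)` is isometric, and functional calculus preserves commutation
  -- with `Q`.
  refine ⟨Q ^ (-(1 / 2) : ℝ), ?_, fun u hu => ?_⟩
  · have hA : ContinuousLinearMap.adjoint (Q ^ (-(1 / 2) : ℝ)) = Q ^ (-(1 / 2) : ℝ) :=
      (IsSelfAdjoint.of_nonneg (CFC.rpow_nonneg (a := Q)))
    have h1 := CFC.conjugate_rpow_neg_one_half Q
    refine (ContinuousLinearMap.norm_map_iff_adjoint_comp_self (B ∘L Q ^ (-(1 / 2) : ℝ))).2 ?_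
    rw [ContinuousLinearMap.adjoint_comp, hA]
    exact h1
  · exact (Commute.cfc_nnreal hu.symm _).symm

variable {G H : Type*} [Group G] [TopologicalSpace G] [IsTopologicalGroup G] [CompactSpace G]
  [Group H] [TopologicalSpace H] [IsTopologicalGroup H] [CompactSpace H]

/-- Averaging `ρ h (f (ι h))` over `H` gives an equivariant operator on continuous functions. -/
theorem exists_average {n : ℕ} (ι : H →ₜ* G) (ρ : H →ₜ* UnitaryOp n) :
    ∃ P : C(G, EuclideanSpace ℂ (Fin n)) →L[ℂ] EuclideanSpace ℂ (Fin n),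
      (∀ h f, P (leftTranslate (ι h) f) = (ρ h : EuclideanSpace ℂ (Fin n) →L[ℂ] _) (P f)) ∧
      ∀ f v, (∀ h, (ρ h : EuclideanSpace ℂ (Fin n) →L[ℂ] _) (f (ι h)) = v) → P f = v := by
  let _ : MeasurableSpace H := borel H
  have : BorelSpace H := ⟨rfl⟩
  let μ : Measure H := Measure.haarMeasure ⊤
  have : IsProbabilityMeasure μ :=
    ⟨by simpa using Measure.haarMeasure_self (K₀ := (⊤ : TopologicalSpace.PositiveCompacts H))⟩
  let V := EuclideanSpace ℂ (Fin n)
  have hc : ∀ f : C(G, V), Continuous fun h => (ρ h : V →L[ℂ] V) (f (ι h)) := fun f =>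
    (continuous_subtype_val.comp ρ.continuous_toFun).clm_apply
      (f.continuous.comp ι.continuous_toFun)
  have hi : ∀ f : C(G, V), Integrable (fun h => (ρ h : V →L[ℂ] V) (f (ι h))) μ := fun f =>
    (hc f).integrable_of_hasCompactSupport (.of_compactSpace _)
  let P₀ : C(G, V) →ₗ[ℂ] V :=
    { toFun := fun f => ∫ h, (ρ h : V →L[ℂ] V) (f (ι h)) ∂μ
      map_add' := fun f g => by simp [integral_add (hi f) (hi g)]
      map_smul' := fun c f => by simp [integral_smul] }
  refine ⟨P₀.mkContinuous 1 fun f => ?_, fun a f => ?_, fun f v hv => ?_⟩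
  · refine (norm_integral_le_of_norm_le_const (C := ‖f‖) (.of_forall fun h => ?_)).trans (by simp)
    rw [ContinuousLinearMap.norm_map_of_mem_unitary (ρ h).2]
    exact f.norm_coe_le_norm _
  · change ∫ h, (ρ h : V →L[ℂ] V) (f ((ι a)⁻¹ * ι h)) ∂μ =
      (ρ a : V →L[ℂ] V) (∫ h, (ρ h : V →L[ℂ] V) (f (ι h)) ∂μ)
    rw [← integral_mul_left_eq_self _ a, ← ContinuousLinearMap.integral_comp_comm _ (hi f)]
    simp
  · change ∫ h, (ρ h : V →L[ℂ] V) (f (ι h)) ∂μ = v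
    simp [hv]

variable [T2Space G]

/-- Every unitary representation of a closed subgroup is contained in the restriction of a unitary
representation of the whole group. -/
theorem exists_extension_unitaryOp {n : ℕ} (ι : H →ₜ* G) (hι : Topology.IsClosedEmbedding ι)
    (ρ : H →ₜ* UnitaryOp n) :
    ∃ (N : ℕ) (σ : G →ₜ* UnitaryOp N)
      (J : EuclideanSpace ℂ (Fin n) →ₗᵢ[ℂ] EuclideanSpace ℂ (Fin N)), ∀ h v,
        (σ (ι h) : EuclideanSpace ℂ (Fin N) →L[ℂ] _) (J v) =
          J ((ρ h : EuclideanSpace ℂ (Fin n) →L[ℂ] _) v) := by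
  let V := EuclideanSpace ℂ (Fin n)
  obtain ⟨P, hP, hPv⟩ := exists_average ι ρ
  have hsurj : ∀ v, ∃ f ∈ finiteVectors G V, P f = v := by
    intro v
    -- Tietze extension of `ρ h⁻¹ v` makes the averaged integrand constantly `v`.
    obtain ⟨f, hf⟩ := ContinuousMap.exists_extension hι
      (⟨fun h => (ρ h⁻¹ : V →L[ℂ] V) v, by
        have h1 : Continuous fun h => ρ h⁻¹ := ρ.continuous_toFun.comp continuous_inv
        exact (continuous_subtype_val.comp h1).clm_apply continuous_const⟩ : C(H, V))
    have hf' : ∀ h, f (ι h) = (ρ h⁻¹ : V →L[ℂ] V) v := fun h => DFunLike.congr_fun hf h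
    have hfv : P f = v := hPv f v fun h => by
      rw [hf', ← mul_apply_eq_comp, ← Submonoid.coe_mul, ← map_mul]
      simp
    -- The image of the finite vectors is dense near `v`, and it is closed as a subspace of a
    -- finite-dimensional space.
    have hcl : v ∈ closure (((finiteVectors G V).map P.toLinearMap : Submodule ℂ V) : Set V) := by
      rw [← hfv]
      exact map_mem_closure P.continuous (dense_finiteVectors f)
        fun g hg => Submodule.mem_map_of_mem hg
    rw [(Submodule.closed_of_finiteDimensional _).closure_eq] at hcl
    exact hcl
  let b := Module.finBasis ℂ V
  choose f hf hfb using fun i => hsurj (b i)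
  choose S hfd hS hfS using fun i => mem_finiteVectors.1 (hf i)
  obtain ⟨N, e, σ, hσ⟩ := (LeftInvariant.iSup hS).exists_unitaryOp
  let E := EuclideanSpace ℂ (Fin N)
  let P' : E →L[ℂ] V :=
    (P.toLinearMap ∘ₗ (⨆ i, S i).subtype ∘ₗ e.symm.toLinearMap).toContinuousLinearMap
  have hP'e : ∀ s, P' (e s) = P s := fun s => by simp [P']
  have hP's : P'.range = ⊤ := by
    rw [eq_top_iff, ← b.span_eq, Submodule.span_le]
    rintro _ ⟨i, rfl⟩
    exact ⟨e ⟨f i, Submodule.mem_iSup_of_mem i (hfS i)⟩, (hP'e _).trans (hfb i)⟩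
  have hP'σ : ∀ h, P' ∘L (σ (ι h) : E →L[ℂ] E) = (ρ h : V →L[ℂ] V) ∘L P' := by
    intro h
    ext1 v
    obtain ⟨s, rfl⟩ := e.surjective v
    change P' ((σ (ι h) : E →L[ℂ] E) (e s)) = (ρ h : V →L[ℂ] V) (P' (e s))
    rw [hσ, hP'e, hP'e, hP]
  -- Passing to adjoints turns the equivariant surjection into an equivariant injection, since
  -- inverses of unitaries are adjoints.
  let B : V →L[ℂ] E := ContinuousLinearMap.adjoint P'
  have hBσ : ∀ h, B ∘L (ρ h : V →L[ℂ] V) = (σ (ι h) : E →L[ℂ] E) ∘L B := by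
    intro h
    have h1 := congrArg ContinuousLinearMap.adjoint (hP'σ h⁻¹)
    rw [ContinuousLinearMap.adjoint_comp, ContinuousLinearMap.adjoint_comp] at h1
    have h2 : ContinuousLinearMap.adjoint (ρ h⁻¹ : V →L[ℂ] V) = ρ h := by
      rw [map_inv]
      exact star_star (ρ h : V →L[ℂ] V)
    have h3 : ContinuousLinearMap.adjoint (σ (ι h⁻¹) : E →L[ℂ] E) = σ (ι h) := by
      rw [map_inv, map_inv]
      exact star_star (σ (ι h) : E →L[ℂ] E)
    rw [h2, h3] at h1
    exact h1.symm
  have hB : Function.Injective B := by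
    rw [injective_iff_map_eq_zero]
    intro v hv
    obtain ⟨w, hw⟩ : v ∈ P'.range := hP's ▸ Submodule.mem_top
    have hw : P' w = v := hw
    rw [← inner_self_eq_zero (𝕜 := ℂ)]
    nth_rewrite 2 [← hw]
    rw [← ContinuousLinearMap.adjoint_inner_left, show ContinuousLinearMap.adjoint P' v = 0 from hv,
      inner_zero_left]
  obtain ⟨A, hA, hAc⟩ := exists_comp_isometry B hB
  refine ⟨N, σ, ⟨(B ∘L A).toLinearMap, hA⟩, fun h v => ?_⟩
  have hcomm : Commute (ρ h : V →L[ℂ] V) (ContinuousLinearMap.adjoint B ∘L B) := by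
    have : ContinuousLinearMap.adjoint B = P' := ContinuousLinearMap.adjoint_adjoint P'
    rw [this]
    change (ρ h : V →L[ℂ] V) ∘L (P' ∘L B) = (P' ∘L B) ∘L (ρ h : V →L[ℂ] V)
    rw [ContinuousLinearMap.comp_assoc, hBσ, ← ContinuousLinearMap.comp_assoc,
      ← ContinuousLinearMap.comp_assoc, hP'σ]
  have h1 := DFunLike.congr_fun (hAc _ hcomm).eq v
  have h2 := DFunLike.congr_fun (hBσ h) (A v)
  exact h2.symm.trans (congrArg B h1)

end Restriction

/-! ### Enlarging unitary representations -/

section Padding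

/-- `ℂᵐ` embeds isometrically into `ℂⁿ` for `m ≤ n`. -/
theorem exists_linearIsometry_of_le {m n : ℕ} (h : m ≤ n) :
    Nonempty (EuclideanSpace ℂ (Fin m) →ₗᵢ[ℂ] EuclideanSpace ℂ (Fin n)) := by
  let b := EuclideanSpace.basisFun (Fin m) ℂ
  let v : Fin m → EuclideanSpace ℂ (Fin n) :=
    fun i => EuclideanSpace.basisFun (Fin n) ℂ (Fin.castLE h i)
  refine ⟨(b.toBasis.constr ℂ v).isometryOfOrthonormal (v := b.toBasis) ?_ ?_⟩
  · simp
  · have : (b.toBasis.constr ℂ v : EuclideanSpace ℂ (Fin m) → _) ∘ b.toBasis = v := by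
      ext1 i
      simp
    rw [this]
    exact (EuclideanSpace.basisFun (Fin n) ℂ).orthonormal.comp _ (Fin.castLE_injective h)

/-- The isometry sending the image of `k₀ ∘ J` to that of `J₀` extends to all of `ℂⁿ` by finite
dimension. This lets representations of different factors share one copy of a subspace. -/
theorem exists_linearIsometry_comp_eq {l m n : ℕ} (h : m ≤ n)
    (J : EuclideanSpace ℂ (Fin l) →ₗᵢ[ℂ] EuclideanSpace ℂ (Fin m))
    (J₀ : EuclideanSpace ℂ (Fin l) →ₗᵢ[ℂ] EuclideanSpace ℂ (Fin n)) :
    ∃ k : EuclideanSpace ℂ (Fin m) →ₗᵢ[ℂ] EuclideanSpace ℂ (Fin n), ∀ v, k (J v) = J₀ v := by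
  obtain ⟨k₀⟩ := exists_linearIsometry_of_le h
  let e := (k₀.comp J).equivRange
  let L := (J₀.comp e.symm.toLinearIsometry).extend
  refine ⟨L.comp k₀, fun v => ?_⟩
  have h1 : L (e v) = J₀ (e.symm (e v)) := LinearIsometry.extend_apply _ _
  rw [e.symm_apply_apply] at h1
  exact h1

variable {G : Type*} [Group G] [TopologicalSpace G]

/-- A unitary representation extends along an isometry, by the trivial representation on the
orthogonal complement. -/
theorem exists_unitaryOp_of_linearIsometry {m n : ℕ}
    (k : EuclideanSpace ℂ (Fin m) →ₗᵢ[ℂ] EuclideanSpace ℂ (Fin n)) (σ : G →ₜ* UnitaryOp m) :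
    ∃ τ : G →ₜ* UnitaryOp n, ∀ a v, (τ a : EuclideanSpace ℂ (Fin n) →L[ℂ] _) (k v) =
      k ((σ a : EuclideanSpace ℂ (Fin m) →L[ℂ] _) v) := by
  let E := EuclideanSpace ℂ (Fin m)
  let F := EuclideanSpace ℂ (Fin n)
  let k' : F →L[ℂ] E := ContinuousLinearMap.adjoint k.toContinuousLinearMap
  have hk : ∀ v, k' (k v) = v := fun v =>
    DFunLike.congr_fun ((ContinuousLinearMap.norm_map_iff_adjoint_comp_self
      k.toContinuousLinearMap).1 k.norm_map) v
  have hkk : ∀ v w, inner ℂ (k v) (w - k (k' w)) = 0 := fun v w => by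
    have : inner ℂ (k v) (w - k (k' w)) = inner ℂ v (k' (w - k (k' w))) :=
      (ContinuousLinearMap.adjoint_inner_right k.toContinuousLinearMap _ _).symm
    rw [this, map_sub, hk, sub_self, inner_zero_right]
  let A : G → F →ₗ[ℂ] F := fun a =>
    (k.toContinuousLinearMap ∘L (σ a : E →L[ℂ] E) ∘L k' +
      (1 - k.toContinuousLinearMap ∘L k')).toLinearMap
  have hA : ∀ a v, A a v = k ((σ a : E →L[ℂ] E) (k' v)) + (v - k (k' v)) := fun _ _ => rfl
  obtain ⟨τ, hτ⟩ := exists_unitaryOp_of_isometric A (fun v => by simp [hA])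
    (fun a b v => by simp [hA, hk])
    (fun a v => by
      -- Pythagoras for the range of `k` and its orthogonal complement, after and before applying `A
      -- a`.
      have h1 := norm_add_sq_eq_norm_sq_add_norm_sq_of_inner_eq_zero _ _
        (hkk ((σ a : E →L[ℂ] E) (k' v)) v)
      have h2 := norm_add_sq_eq_norm_sq_add_norm_sq_of_inner_eq_zero _ _ (hkk (k' v) v)
      rw [add_sub_cancel, k.norm_map] at h2
      rw [k.norm_map, ContinuousLinearMap.norm_map_of_mem_unitary (σ a).2, ← h2, ← hA] at h1
      nlinarith [norm_nonneg (A a v), norm_nonneg v])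
    (fun v => by
      simp only [hA]
      refine (k.continuous.comp ?_).add continuous_const
      exact (continuous_subtype_val.comp σ.continuous_toFun).clm_apply continuous_const)
  refine ⟨τ, fun a v => ?_⟩
  rw [hτ, hA, hk, sub_self, add_zero]

/-- The elements at which an isometry intertwines two unitary representations form a closed
subgroup. -/
theorem exists_intertwining_subgroup {m n : ℕ} (ρ : G →ₜ* UnitaryOp m) (θ : G →ₜ* UnitaryOp n)
    (J : EuclideanSpace ℂ (Fin m) →ₗᵢ[ℂ] EuclideanSpace ℂ (Fin n)) :
    ∃ S : Subgroup G, IsClosed (S : Set G) ∧ ∀ x, x ∈ S ↔ ∀ v,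
      (θ x : EuclideanSpace ℂ (Fin n) →L[ℂ] _) (J v) =
        J ((ρ x : EuclideanSpace ℂ (Fin m) →L[ℂ] _) v) := by
  have hmul : ∀ {k : ℕ} (σ : G →ₜ* UnitaryOp k) (x y : G) (v : EuclideanSpace ℂ (Fin k)),
      (σ (x * y)).1 v = (σ x).1 ((σ y).1 v) := fun σ x y v => by
    rw [map_mul]
    rfl
  let S : Subgroup G :=
    { carrier := {x | ∀ v, (θ x : EuclideanSpace ℂ (Fin n) →L[ℂ] _) (J v) =
        J ((ρ x : EuclideanSpace ℂ (Fin m) →L[ℂ] _) v)}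
      one_mem' := fun v => by simp
      mul_mem' := fun {x y} hx hy v => by
        rw [hmul, hmul, hy, hx]
      inv_mem' := fun {x} hx v => by
        have h := hx ((ρ x⁻¹ : EuclideanSpace ℂ (Fin m) →L[ℂ] _) v)
        rw [← hmul, mul_inv_cancel] at h
        have h1 : (ρ 1 : EuclideanSpace ℂ (Fin m) →L[ℂ] _) v = v := by simp
        rw [h1] at h
        rw [← h, ← hmul, inv_mul_cancel]
        simp }
  refine ⟨S, ?_, fun x => Iff.rfl⟩
  change IsClosed {x | ∀ v, (θ x : EuclideanSpace ℂ (Fin n) →L[ℂ] _) (J v) =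
    J ((ρ x : EuclideanSpace ℂ (Fin m) →L[ℂ] _) v)}
  rw [Set.ofPred_forall]
  refine isClosed_iInter fun v => isClosed_eq ?_ (J.continuous.comp ?_)
  · exact (continuous_subtype_val.comp θ.continuous_toFun).clm_apply continuous_const
  · exact (continuous_subtype_val.comp ρ.continuous_toFun).clm_apply continuous_const

end Padding

namespace CGp

/-- A coproduct of compact groups is topologically generated by its factors. -/
theorem closedSubgroup_sigma_eq_top {I : Type w} (H : I → CGp.{u}) [HasCoproduct H]
    (S : Subgroup (∐ H : CGp.{u})) (hS : IsClosed (S : Set (∐ H : CGp.{u})))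
    (h : ∀ i (y : H i), (Sigma.ι H i).hom' y ∈ S) : S = ⊤ := by
  have : CompactSpace S := isCompact_iff_compactSpace.1 hS.isCompact
  let K : CGp.{u} := ⟨S⟩
  let j : K ⟶ ∐ H := ⟨⟨S.subtype, continuous_subtype_val⟩⟩
  -- The factors map into the compact group `S`, so the universal property gives a section of its
  -- inclusion, which is therefore onto.
  let r : (∐ H) ⟶ K := Sigma.desc fun i =>
    ⟨⟨(Sigma.ι H i).hom'.toMonoidHom.codRestrict S (h i),
      (Sigma.ι H i).hom'.continuous_toFun.subtype_mk _⟩⟩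
  have hr : r ≫ j = 𝟙 (∐ H) := by
    refine Sigma.hom_ext _ _ fun i => ?_
    rw [Sigma.ι_desc_assoc, Category.comp_id]
    rfl
  rw [eq_top_iff]
  intro x _
  have hx : j.hom' (r.hom' x) = x := congrArg (fun f : (∐ H) ⟶ (∐ H) => f.hom' x) hr
  rw [← hx]
  exact (r.hom' x).2

/-- The compact group of unitary operators of `ℂⁿ`. -/
noncomputable def unitaryOp (n : ℕ) : CGp.{u} := ⟨ULift.{u} (UnitaryOp n)⟩

/-- Unitary representations as morphisms of compact groups. -/
noncomputable def homOfUnitaryOp {G : CGp.{u}} {n : ℕ} (σ : G →ₜ* UnitaryOp n) : G ⟶ unitaryOp n :=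
  ⟨⟨MulEquiv.ulift.symm.toMonoidHom.comp σ.toMonoidHom,
    continuous_uliftUp.comp σ.continuous_toFun⟩⟩

/-- Morphisms to the unitary group as unitary representations. -/
noncomputable def unitaryOpOfHom {G : CGp.{u}} {n : ℕ} (f : G ⟶ unitaryOp n) :
    G →ₜ* UnitaryOp n :=
  ⟨(MulEquiv.ulift : ULift.{u} (UnitaryOp n) ≃* _).toMonoidHom.comp f.hom'.toMonoidHom,
    continuous_uliftDown.comp f.hom'.continuous_toFun⟩

theorem unitaryOpOfHom_comp_apply {H G : CGp.{u}} {n : ℕ} (g : H ⟶ G) (f : G ⟶ unitaryOp n)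
    (x : H) : unitaryOpOfHom (g ≫ f) x = unitaryOpOfHom f (g.hom' x) := rfl

/-- Unitary representations of a finite coproduct `∐ H` are contained in restrictions of unitary
representations of `∐ G`. -/
theorem exists_hom_unitaryOp_sigma {I : Type w} [Finite I] {H G : I → CGp.{u}}
    (ι : ∀ i, H i ⟶ G i) (hι : ∀ i, CGp.IsEmbedding (ι i)) {n : ℕ}
    (ρ : (∐ H : CGp.{u}) →ₜ* UnitaryOp n) :
    ∃ (N : ℕ) (τ : (∐ G : CGp.{u}) →ₜ* UnitaryOp N)
      (J : EuclideanSpace ℂ (Fin n) →ₗᵢ[ℂ] EuclideanSpace ℂ (Fin N)), ∀ x v,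
        (τ ((Limits.Sigma.map ι).hom' x) : EuclideanSpace ℂ (Fin N) →L[ℂ] _) (J v) =
          J ((ρ x : EuclideanSpace ℂ (Fin n) →L[ℂ] _) v) := by
  have := Fintype.ofFinite I
  have hι' : ∀ i, Topology.IsClosedEmbedding (ι i).hom' := fun i =>
    (ι i).hom'.continuous_toFun.isClosedEmbedding (hι i).injective
  choose M σ J hJ using fun i =>
    exists_extension_unitaryOp (ι i).hom' (hι' i) (ρ.comp (Sigma.ι H i).hom')
  -- One dimension that accommodates `ρ` and all factors; it exists because `I` is finite.
  let N := n ⊔ Finset.univ.sup M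
  obtain ⟨J₀⟩ := exists_linearIsometry_of_le (le_sup_left : n ≤ N)
  -- Now `k i ∘ J i = J₀` for every `i`, so a single isometry intertwines on all factors.
  choose k hk using fun i => exists_linearIsometry_comp_eq
    ((Finset.le_sup (Finset.mem_univ i)).trans le_sup_right : M i ≤ N) (J i) J₀
  choose σ' hσ' using fun i => exists_unitaryOp_of_linearIsometry (k i) (σ i)
  let τ : (∐ G) ⟶ unitaryOp N := Sigma.desc fun i => homOfUnitaryOp (σ' i)
  obtain ⟨S, hSc, hS⟩ :=
    exists_intertwining_subgroup ρ (unitaryOpOfHom (Limits.Sigma.map ι ≫ τ)) J₀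
  have hτ : ∀ i (y : H i), unitaryOpOfHom (Limits.Sigma.map ι ≫ τ) ((Sigma.ι H i).hom' y) =
      σ' i ((ι i).hom' y) := by
    intro i y
    have : Sigma.ι H i ≫ Limits.Sigma.map ι ≫ τ = ι i ≫ homOfUnitaryOp (σ' i) := by simp [τ]
    rw [← unitaryOpOfHom_comp_apply, this]
    rfl
  have hStop : S = ⊤ := closedSubgroup_sigma_eq_top H S hSc fun i y => by
    rw [hS]
    intro v
    rw [hτ, ← hk i, hσ', hJ i y v]
    exact hk i _
  refine ⟨N, unitaryOpOfHom τ, J₀, fun x v => ?_⟩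
  exact (hS x).1 (hStop ▸ Subgroup.mem_top x) v

end CGp

theorem mainTheorem11 {I : Type w} [Finite I] (H G : I → CGp.{u}) (ι : ∀ i, H i ⟶ G i)
    (hι : ∀ i, CGp.IsEmbedding (ι i)) :
    CGp.IsEmbedding (Limits.Sigma.map ι : (∐ H) ⟶ (∐ G)) := by
  have hinj : Function.Injective (Limits.Sigma.map ι : (∐ H) ⟶ (∐ G)).hom' := by
    rw [injective_iff_map_eq_one]
    intro x hx
    by_contra hx1
    obtain ⟨n, ρ, hρ⟩ := exists_unitaryOp_ne_one hx1
    obtain ⟨N, τ, J, hJ⟩ := CGp.exists_hom_unitaryOp_sigma ι hι ρ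
    refine hρ (Subtype.ext (ContinuousLinearMap.ext fun v => J.injective ?_))
    rw [← hJ x v, hx, map_one]
    rfl
  exact ((Limits.Sigma.map ι : (∐ H) ⟶ (∐ G)).hom'.continuous_toFun.isClosedEmbedding
    hinj).isEmbedding
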